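/- Let $b\ge 1$ be an integer and $r=\frac{b}{2b+1}$. Let $G_0$ be the graph with two vertices $q_1,q_2$ joined by one edge, and let $G_{\ell+1}$ arise from $G_\ell$ by replacing every edge $\{x,y\}$ by two new vertices $x',y'$, one edge $\{x,x'\}$, one edge $\{y',y\}$ and $b$ parallel edges $\{x',y'\}$. Let $V_*$ be the union of the vertex sets. Equivalently, $G_{\ell+1}$ is obtained by gluing $b+2$ copies of $G_\ell$ along $G_1$ via maps $F_1,\dots,F_{b+2}:V_*\to V_*$, where $F_1,\dots,F_b$ correspond to the parallel edges of $G_1$, $F_{b+1}$ to the edge at $q_1$ (with $F_{b+1}q_1=q_1$) and $F_{b+2}$ to the edge at $q_2$ (with $F_{b+2}q_2=q_2$). For $f:V_*\to\mathbb R$ put $\mathcal E_\ell(f)=r^{-\ell}\sum_{\{p,q\}\in E(G_\ell)}|f(p)-f(q)|^2$ (edges counted with multiplicity), $\mathcal E(f)=\lim_{\ell}\mathcal E_\ell(f)$, $\operatorname{dom}\mathcal E=\{f:\mathcal E(f)<\infty\}$ and $\mathcal E(f,g)=\frac14(\mathcal E(f+g)-\mathcal E(f-g))$. Let $R(p,q)$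 be the least $R$ with $|f(p)-f(q)|^2\le R\,\mathcal E(f)$ for all $f\in\operatorname{dom}\mathcal E$, and let the bubble-diamond fractal $K_b$ be the completion of $V_*$ in the metric $R$; functions in $\operatorname{dom}\mathcal E$ and the maps $F_i$ are extended continuously to $K_b$. Let $\mu$ be the self-similar Borel probability measure on $K_b$, $\mu(A)=\frac1{b+2}\sum_{i=1}^{b+2}\mu(F_i^{-1}A)$, and let $\langle u,v\rangle=\int_{K_b}uv\,d\mu$. For $u\in\operatorname{dom}\mathcal E$ and $f$ continuous on $K_b$, write $u\in\operatorname{dom}\Delta$, $\Delta u=f$ if $\mathcal E(u,g)=-\int_{K_b}fg\,d\mu$ for all $g\in\operatorname{dom}\mathcal E$ with $g(q_1)=g(q_2)=0$. The normal derivatives of $u$ at the boundary points are $$\partial_nu(q_1)=\lim_{m\to\infty}r^{-m}\bigl(u(q_1)-u(F_{b+1}^{m}q_2)\bigr),\qquad \partial_nu(q_2)=\lim_{m\to\infty}r^{-m}\bigl(u(q_2)-u(F_{b+2}^{m}q_1)\bigr).$$ For $j\ge0$ and $k\in\{1,2\}$ let the monomial $P_{jk}$ be the function with $\Delta^{j+1}P_{jk}=0$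 and $$\Delta^mP_{jk}(q_1)=\delta_{mj}\delta_{k1},\qquad \partial_n\Delta^mP_{jk}(q_1)=\delta_{mj}\delta_{k2}\qquad(0\le m\le j).$$ **Theorem.** The normal derivatives of all $P_{jk}$ at $q_2$ exist, and with $$\alpha_j=P_{j1}(q_2),\quad \beta_j=P_{j2}(q_2),\quad \eta_j=\partial_nP_{j1}(q_2),\quad \gamma_j=\partial_nP_{j2}(q_2)$$ one has, for all $j,j'\ge 0$, $$\langle P_{j1},P_{j'1}\rangle=\sum_{\ell=0}^{j}\bigl(\alpha_{j-\ell}\,\eta_{j'+\ell+1}-\alpha_{j'+\ell+1}\,\eta_{j-\ell}\bigr),$$ $$\langle P_{j1},P_{j'2}\rangle=\sum_{\ell=0}^{j}\bigl(\alpha_{j-\ell}\,\gamma_{j'+\ell+1}-\beta_{j'+\ell+1}\,\eta_{j-\ell}\bigr),$$ $$\langle P_{j2},P_{j'2}\rangle=\sum_{\ell=0}^{j}\bigl(\beta_{j-\ell}\,\gamma_{j'+\ell+1}-\beta_{j'+\ell+1}\,\gamma_{j-\ell}\bigr).$$ -/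

import Mathlib

open MeasureTheory Filter Topology

namespace BubbleDiamond

/-! ## The bubble-diamond graphs -/

/-- The vertices of the union `V_*` of the bubble-diamond graphs with branching parameter `b`:
the two boundary points `q₁, q₂` (`bdry 0`, `bdry 1`), and, for every finite word `w` over
`{1, …, b+2}`, the two vertices `node w 0`, `node w 1` that are introduced when the edge of
`G_{|w|}` with address `w` is modified; `node w k` is joined to the `k`-th endpoint of that edge. -/
inductive Vertex (b : ℕ) : Type
  | bdry (k : Fin 2) : Vertex b
  | node (w : List (Fin (b + 2))) (k : Fin 2) : Vertex b

variable {b : ℕ}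

/-- The gluing maps `F_i : V_* → V_*`. The indices `0, …, b-1` are the copies placed on the `b`
parallel middle edges of `G_1`; the index `b` (that is, `F_{b+1}` when counting from one) is the
copy at `q₁`; the index `b+1` (that is, `F_{b+2}`) is the copy at `q₂`. -/
def F (i : Fin (b + 2)) : Vertex b → Vertex b
  | .bdry k =>
      if i.val = b then (if k = 0 then .bdry 0 else .node [] 0)
      else if i.val = b + 1 then (if k = 0 then .node [] 1 else .bdry 1)
      else .node [] k
  | .node w k => .node (i :: w) k

/-- `F_w = F_{w₁} ∘ ⋯ ∘ F_{w_m}` for a word `w = w₁ ⋯ w_m`. -/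
def FWord : List (Fin (b + 2)) → Vertex b → Vertex b
  | [], p => p
  | i :: w, p => F i (FWord w p)

/-- The edges of `G_ℓ` are indexed by the words of length `ℓ`; the edge with address `w` has the
endpoints `F_w q₁` and `F_w q₂`. The rule by which `G_{ℓ+1}` is obtained from `G_ℓ` is the
statement that the edges with addresses `w i` come from the edge with address `w` as follows. -/
theorem edge_subdivision (w : List (Fin (b + 2))) (i : Fin (b + 2)) :
    (FWord (w ++ [i]) (.bdry 0), FWord (w ++ [i]) (.bdry 1)) =
      if i.val = b then (FWord w (.bdry 0), .node w 0)
      else if i.val = b + 1 then (.node w 1, FWord w (.bdry 1))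
      else (.node w 0, .node w 1) := by
  have key : ∀ (v : List (Fin (b + 2))) (p : Vertex b),
      FWord (v ++ [i]) p = FWord v (F i p) := by
    intro v p
    induction v with
    | nil => rfl
    | cons a v ih => simp only [List.cons_append, FWord, ih]
  have key2 : ∀ (v : List (Fin (b + 2))) (k : Fin 2), FWord v (.node [] k) = .node v k := by
    intro v k
    induction v with
    | nil => rfl
    | cons a v ih => simp only [FWord, ih, F]
  rw [key, key]
  split_ifs with h1 h2
  · simp [F, h1, key2]
  · simp [F, h2, key2]
  · simp [F, h1, h2, key2]

/-! ## Energy -/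

/-- The renormalization constant `r = b / (2b + 1)`. -/
noncomputable def r (b : ℕ) : ℝ := (b : ℝ) / (2 * b + 1)

/-- The graph energy `𝓔_ℓ(f) = r^{-ℓ} ∑ |f(p) - f(q)|²`, the sum being over the edges of `G_ℓ`
(parallel edges counted with multiplicity). -/
noncomputable def graphEnergy (ℓ : ℕ) (f : Vertex b → ℝ) : ℝ :=
  (r b ^ ℓ)⁻¹ * ∑ w : Fin ℓ → Fin (b + 2),
    (f (FWord (List.ofFn w) (.bdry 0)) - f (FWord (List.ofFn w) (.bdry 1))) ^ 2

/-- `f ∈ dom 𝓔`: the limit of the graph energies of `f` exists and is finite. -/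
def FiniteEnergy (f : Vertex b → ℝ) : Prop :=
  ∃ c : ℝ, Tendsto (fun ℓ => graphEnergy ℓ f) atTop (𝓝 c)

/-- The energy `𝓔(f) = lim 𝓔_ℓ(f)` of a function `f ∈ dom 𝓔`. -/
noncomputable def energy (f : Vertex b → ℝ) : ℝ :=
  limUnder atTop (fun ℓ => graphEnergy ℓ f)

/-- The bilinear form `𝓔(f, g)`, by polarization. -/
noncomputable def energyForm (f g : Vertex b → ℝ) : ℝ :=
  (energy (f + g) - energy (f - g)) / 4

/-- The set of all `R ≥ 0` with `|f(p) - f(q)|² ≤ R 𝓔(f)` for all `f ∈ dom 𝓔`. -/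
def resistanceBounds (p q : Vertex b) : Set ℝ :=
  {R | 0 ≤ R ∧ ∀ f : Vertex b → ℝ, FiniteEnergy f → (f p - f q) ^ 2 ≤ R * energy f}

/-- The resistance metric: the least element of `resistanceBounds p q`. -/
noncomputable def resistance (p q : Vertex b) : ℝ := sInf (resistanceBounds p q)

theorem r_pos [NeZero b] : 0 < r b := by
  have : 0 < (b : ℝ) := by exact_mod_cast Nat.pos_of_ne_zero (NeZero.ne b)
  unfold r; positivity

theorem r_nonneg : 0 ≤ r b := by unfold r; positivity

theorem r_le_half : r b ≤ 1 / 2 := by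
  unfold r
  rw [div_le_div_iff₀ (by positivity) (by norm_num)]
  linarith

theorem graphEnergy_nonneg (ℓ : ℕ) (f : Vertex b → ℝ) : 0 ≤ graphEnergy ℓ f :=
  mul_nonneg (inv_nonneg.2 (pow_nonneg r_nonneg _)) (Finset.sum_nonneg fun _ _ => sq_nonneg _)

theorem graphEnergy_zero (f : Vertex b → ℝ) :
    graphEnergy 0 f = (f (.bdry 0) - f (.bdry 1)) ^ 2 := by
  simp [graphEnergy, FWord]

theorem graphEnergy_succ (ℓ : ℕ) (f : Vertex b → ℝ) :
    graphEnergy (ℓ + 1) f = (r b)⁻¹ * ∑ i, graphEnergy ℓ (f ∘ F i) := by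
  simp only [graphEnergy]
  rw [← Finset.mul_sum, ← mul_assoc, pow_succ', mul_inv]
  congr 1
  rw [← (Fin.consEquiv (fun _ : Fin (ℓ + 1) => Fin (b + 2))).sum_comp, Fintype.sum_prod_type]
  refine Finset.sum_congr rfl fun i _ => Finset.sum_congr rfl fun w _ => ?_
  simp [Fin.consEquiv, List.ofFn_succ, FWord]

theorem graphEnergy_mono [NeZero b] (f : Vertex b → ℝ) :
    Monotone (fun ℓ => graphEnergy ℓ f) := by
  refine monotone_nat_of_le_succ fun ℓ => ?_
  induction ℓ generalizing f with
  | zero =>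
    have hb : 0 < (b : ℝ) := by exact_mod_cast Nat.pos_of_ne_zero (NeZero.ne b)
    rw [graphEnergy_succ, Fin.sum_univ_castSucc, Fin.sum_univ_castSucc]
    have hmid : ∀ i : Fin b, graphEnergy 0 (f ∘ F (i.castSucc.castSucc)) =
        (f (.node [] 0) - f (.node [] 1)) ^ 2 := by
      intro i
      have h1 : (i : ℕ) ≠ b := i.2.ne
      have h2 : (i : ℕ) ≠ b + 1 := by have := i.2; omega
      simp [graphEnergy_zero, F, h1, h2]
    have h1 : graphEnergy 0 (f ∘ F (Fin.last b).castSucc) =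
        (f (.bdry 0) - f (.node [] 0)) ^ 2 := by simp [graphEnergy_zero, F]
    have h2 : graphEnergy 0 (f ∘ F (Fin.last (b + 1))) =
        (f (.node [] 1) - f (.bdry 1)) ^ 2 := by simp [graphEnergy_zero, F]
    rw [Finset.sum_congr rfl fun i _ => hmid i, h1, h2, graphEnergy_zero]
    simp only [Finset.sum_const, Finset.card_univ, Fintype.card_fin, nsmul_eq_mul]
    generalize f (.bdry 0) = x, f (.node [] 0) = p, f (.node [] 1) = s, f (.bdry 1) = y
    unfold r
    rw [inv_div, div_mul_eq_mul_div, le_div_iff₀ hb]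
    obtain ⟨u, hu⟩ : ∃ u, u = x - p := ⟨_, rfl⟩
    obtain ⟨v, hv⟩ : ∃ v, v = p - s := ⟨_, rfl⟩
    obtain ⟨z, hz⟩ : ∃ z, z = s - y := ⟨_, rfl⟩
    rw [← hu, ← hv, ← hz, show x - y = u + v + z by rw [hu, hv, hz]; ring]
    nlinarith [sq_nonneg (u - b * v), sq_nonneg (z - b * v), mul_nonneg hb.le (sq_nonneg (u - z)),
      sq_nonneg (u - z)]
  | succ ℓ ih =>
    rw [graphEnergy_succ (ℓ + 1), graphEnergy_succ ℓ]
    exact mul_le_mul_of_nonneg_left (Finset.sum_le_sum fun i _ => ih _)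
      (inv_nonneg.2 r_nonneg)

theorem FiniteEnergy.tendsto {f : Vertex b → ℝ} (hf : FiniteEnergy f) :
    Tendsto (fun ℓ => graphEnergy ℓ f) atTop (𝓝 (energy f)) :=
  tendsto_nhds_limUnder hf

theorem FiniteEnergy.le [NeZero b] {f : Vertex b → ℝ} (hf : FiniteEnergy f) (ℓ : ℕ) :
    graphEnergy ℓ f ≤ energy f :=
  (graphEnergy_mono f).ge_of_tendsto hf.tendsto ℓ

theorem finiteEnergy_of_le [NeZero b] {f : Vertex b → ℝ} {C : ℝ}
    (h : ∀ ℓ, graphEnergy ℓ f ≤ C) : FiniteEnergy f :=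
  ⟨_, tendsto_atTop_ciSup (graphEnergy_mono f) ⟨C, by rintro _ ⟨ℓ, rfl⟩; exact h ℓ⟩⟩

theorem FiniteEnergy.comp_F [NeZero b] {f : Vertex b → ℝ} (hf : FiniteEnergy f)
    (i : Fin (b + 2)) : FiniteEnergy (f ∘ F i) ∧ energy (f ∘ F i) ≤ r b * energy f := by
  have h : ∀ ℓ, graphEnergy ℓ (f ∘ F i) ≤ r b * energy f := by
    intro ℓ
    have h1 := hf.le (ℓ + 1)
    rw [graphEnergy_succ, inv_mul_le_iff₀ r_pos] at h1
    exact (Finset.single_le_sum (f := fun i => graphEnergy ℓ (f ∘ F i))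
      (fun i _ => graphEnergy_nonneg _ _) (Finset.mem_univ i)).trans h1
  exact ⟨finiteEnergy_of_le h, le_of_tendsto' (finiteEnergy_of_le h).tendsto h⟩

theorem energy_nonneg {f : Vertex b → ℝ} (hf : FiniteEnergy f) : 0 ≤ energy f :=
  ge_of_tendsto' hf.tendsto fun ℓ => graphEnergy_nonneg ℓ f

/-! ## The resistance metric and the fractal -/

theorem resistanceBounds_comm (p q : Vertex b) : resistanceBounds p q = resistanceBounds q p := by
  ext R
  simp only [resistanceBounds, Set.mem_ofPred_eq, sub_sq_comm]

theorem resistanceBounds_trans [NeZero b] {p q s : Vertex b} {R S : ℝ}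
    (hR : R ∈ resistanceBounds p q) (hS : S ∈ resistanceBounds q s) :
    R + S ∈ resistanceBounds p s := by
  refine ⟨add_nonneg hR.1 hS.1, fun f hf => ?_⟩
  set t := f q with ht
  let f₁ : Vertex b → ℝ := fun x => max (f x) t
  let f₂ : Vertex b → ℝ := fun x => min (f x) t
  have hle : ∀ ℓ, graphEnergy ℓ f₁ + graphEnergy ℓ f₂ ≤ graphEnergy ℓ f := by
    intro ℓ
    simp only [graphEnergy]
    rw [← mul_add, ← Finset.sum_add_distrib]
    refine mul_le_mul_of_nonneg_left (Finset.sum_le_sum fun w _ => ?_)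
      (inv_nonneg.2 (pow_nonneg r_nonneg _))
    generalize FWord (List.ofFn w) (.bdry 0) = x, FWord (List.ofFn w) (.bdry 1) = y
    simp only [f₁, f₂]
    rcases le_total (f x) t with h1 | h1 <;> rcases le_total (f y) t with h2 | h2 <;>
      simp only [h1, h2, max_eq_left, max_eq_right, min_eq_left, min_eq_right] <;>
      nlinarith [mul_nonneg (sub_nonneg.2 h1) (sub_nonneg.2 h2)]
  have hF₁ : FiniteEnergy f₁ := finiteEnergy_of_le (C := energy f) fun ℓ => by
    linarith [hle ℓ, hf.le ℓ, graphEnergy_nonneg ℓ f₂]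
  have hF₂ : FiniteEnergy f₂ := finiteEnergy_of_le (C := energy f) fun ℓ => by
    linarith [hle ℓ, hf.le ℓ, graphEnergy_nonneg ℓ f₁]
  have hE : energy f₁ + energy f₂ ≤ energy f :=
    le_of_tendsto_of_tendsto' (hF₁.tendsto.add hF₂.tendsto) hf.tendsto hle
  have e0 := energy_nonneg hf
  have a1 := hR.2 f hf
  have a2 := hS.2 f hf
  have b1 := hR.2 _ hF₁
  have b2 := hS.2 _ hF₁
  have c1 := hR.2 _ hF₂
  have c2 := hS.2 _ hF₂
  have e1 := energy_nonneg hF₁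
  have e2 := energy_nonneg hF₂
  have hR0 := hR.1
  have hS0 := hS.1
  simp only [f₁, f₂, ← ht, max_self, min_self] at b1 b2 c1 c2
  rw [← ht] at a1 a2
  have cs : ∀ x y A B : ℝ, 0 ≤ A → 0 ≤ B → x ^ 2 ≤ R * A → y ^ 2 ≤ S * B → A + B ≤ energy f →
      (x + y) ^ 2 ≤ (R + S) * energy f := by
    intro x y A B hA hB hx hy hAB
    have h1 : (x + y) ^ 2 ≤ (R + S) * (A + B) := by
      have h2 : (2 * (x * y)) ^ 2 ≤ (R * B + S * A) ^ 2 := by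
        have h3 : x ^ 2 * y ^ 2 ≤ (R * A) * (S * B) :=
          mul_le_mul hx hy (sq_nonneg _) (mul_nonneg hR0 hA)
        nlinarith [sq_nonneg (R * B - S * A)]
      have h4 := abs_le_of_sq_le_sq h2 (add_nonneg (mul_nonneg hR0 hB) (mul_nonneg hS0 hA))
      nlinarith [le_abs_self (2 * (x * y))]
    exact h1.trans (mul_le_mul_of_nonneg_left hAB (add_nonneg hR0 hS0))
  rcases le_total (f p) t with h1 | h1 <;> rcases le_total (f s) t with h2 | h2
  · rcases le_total (f p) (f s) with h3 | h3
    · nlinarith [mul_nonneg hS0 e0]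
    · nlinarith [mul_nonneg hR0 e0]
  · rw [max_eq_left h2] at b2
    rw [min_eq_left h1] at c1
    have := cs _ _ _ _ e2 e1 c1 b2 (by linarith)
    simpa using this
  · rw [max_eq_left h1] at b1
    rw [min_eq_left h2] at c2
    have := cs _ _ _ _ e1 e2 b1 c2 hE
    simpa using this
  · rcases le_total (f p) (f s) with h3 | h3
    · nlinarith [mul_nonneg hR0 e0]
    · nlinarith [mul_nonneg hS0 e0]

theorem resistanceBounds_F [NeZero b] {p q : Vertex b} {R : ℝ} (hR : R ∈ resistanceBounds p q)
    (i : Fin (b + 2)) : r b * R ∈ resistanceBounds (F i p) (F i q) := by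
  refine ⟨mul_nonneg r_nonneg hR.1, fun f hf => ?_⟩
  obtain ⟨h1, h2⟩ := hf.comp_F i
  have h3 := hR.2 _ h1
  have h4 := mul_le_mul_of_nonneg_left h2 hR.1
  simp only [Function.comp_apply] at h3
  linarith

theorem resistanceBounds_nonempty_aux [NeZero b] (p : Vertex b) :
    (resistanceBounds p (.bdry 0)).Nonempty := by
  have hself : ∀ p : Vertex b, (0 : ℝ) ∈ resistanceBounds p p :=
    fun p => ⟨le_rfl, fun f _ => by simp⟩
  have h01 : (1 : ℝ) ∈ resistanceBounds (.bdry 0 : Vertex b) (.bdry 1) :=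
    ⟨zero_le_one, fun f hf => by have := hf.le 0; rwa [graphEnergy_zero, ← one_mul (energy f)] at this⟩
  have hn0 : (resistanceBounds (.node [] 0 : Vertex b) (.bdry 0)).Nonempty := by
    have := resistanceBounds_F h01 (Fin.last b).castSucc
    simp only [F, Fin.val_castSucc, Fin.val_last, if_true, one_ne_zero, if_false] at this
    rw [resistanceBounds_comm] at this
    exact ⟨_, this⟩
  have hn1 : (resistanceBounds (.node [] 1 : Vertex b) (.bdry 0)).Nonempty := by
    have h := resistanceBounds_F h01 (Fin.last (b + 1))
    simp only [F, Fin.val_last, if_true, one_ne_zero, if_false, Nat.succ_ne_self] at h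
    rw [resistanceBounds_comm] at h01
    exact ⟨_, resistanceBounds_trans h h01⟩
  have hF0 : ∀ i : Fin (b + 2), (resistanceBounds (F i (.bdry 0)) (.bdry 0)).Nonempty := by
    intro i
    simp only [F, if_true]
    split_ifs
    · exact ⟨_, hself _⟩
    · exact hn1
    · exact hn0
  cases p with
  | bdry k =>
    fin_cases k
    · exact ⟨_, hself _⟩
    · rw [resistanceBounds_comm] at h01
      exact ⟨_, h01⟩
  | node w k =>
    induction w with
    | nil =>
      fin_cases k
      · exact hn0
      · exact hn1
    | cons i w ih =>
      obtain ⟨R, hR⟩ := ih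
      obtain ⟨S, hS⟩ := hF0 i
      exact ⟨_, resistanceBounds_trans (resistanceBounds_F hR i) hS⟩

theorem resistanceBounds_nonempty [NeZero b] (p q : Vertex b) :
    (resistanceBounds p q).Nonempty := by
  obtain ⟨R, hR⟩ := resistanceBounds_nonempty_aux p
  obtain ⟨S, hS⟩ := resistanceBounds_nonempty_aux q
  rw [resistanceBounds_comm] at hS
  exact ⟨_, resistanceBounds_trans hR hS⟩

theorem resistance_isLeast [NeZero b] (p q : Vertex b) :
    IsLeast (resistanceBounds p q) (resistance p q) := by
  have hb : BddBelow (resistanceBounds p q) := ⟨0, fun R hR => hR.1⟩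
  refine ⟨⟨le_csInf (resistanceBounds_nonempty p q) fun R hR => hR.1, fun f hf => ?_⟩,
    fun R hR => csInf_le hb hR⟩
  rcases (energy_nonneg hf).eq_or_lt with h | h
  · obtain ⟨R, hR⟩ := resistanceBounds_nonempty p q
    have := hR.2 f hf
    rw [← h] at this ⊢
    simpa using this
  · rw [← div_le_iff₀ h]
    refine le_csInf (resistanceBounds_nonempty p q) fun R hR => ?_
    rw [div_le_iff₀ h]
    exact hR.2 f hf

/-- `V_*` with the resistance metric. Only the axioms of a pseudometric are needed to form the
(separated) completion. -/
noncomputable instance [NeZero b] : PseudoMetricSpace (Vertex b) where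
  dist := resistance
  dist_self p := le_antisymm ((resistance_isLeast p p).2 ⟨le_rfl, fun f _ => by simp⟩)
    (resistance_isLeast p p).1.1
  dist_comm p q := by unfold resistance; rw [resistanceBounds_comm]
  dist_triangle p q s := (resistance_isLeast p s).2
    (resistanceBounds_trans (resistance_isLeast p q).1 (resistance_isLeast q s).1)

theorem F_lipschitz [NeZero b] (i : Fin (b + 2)) :
    LipschitzWith (r b).toNNReal (F i) := by
  refine LipschitzWith.of_dist_le_mul fun p q => ?_
  rw [Real.coe_toNNReal _ r_nonneg]
  exact (resistance_isLeast (F i p) (F i q)).2 (resistanceBounds_F (resistance_isLeast p q).1 i)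

/-- The bubble-diamond fractal `K_b`: the completion of `V_*` in the resistance metric. -/
abbrev K (b : ℕ) [NeZero b] : Type := UniformSpace.Completion (Vertex b)

noncomputable instance [NeZero b] : MeasurableSpace (K b) := borel (K b)

instance [NeZero b] : BorelSpace (K b) := ⟨rfl⟩

/-- The boundary points: `q 0` and `q 1` are `q₁` and `q₂`. -/
noncomputable def q [NeZero b] (k : Fin 2) : K b := ((.bdry k : Vertex b) : K b)

instance [NeZero b] : Nonempty (K b) := ⟨q 0⟩

/-- The continuous extension of `F_i` to a map `K_b → K_b`. -/
noncomputable def FK [NeZero b] (i : Fin (b + 2)) : K b → K b :=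
  UniformSpace.Completion.map (F i)

theorem FK_coe [NeZero b] (i : Fin (b + 2)) (p : Vertex b) : FK i (p : K b) = (F i p : Vertex b) :=
  UniformSpace.Completion.map_coe (F_lipschitz i).uniformContinuous p

theorem continuous_FK [NeZero b] (i : Fin (b + 2)) : Continuous (FK i : K b → K b) :=
  UniformSpace.Completion.continuous_map

/-! ## The self-similar measure -/

/-- The sequence `i, ω₀, ω₁, …`. -/
def consSeq {X : Type*} (i : X) (ω : ℕ → X) : ℕ → X
  | 0 => i
  | m + 1 => ω m

/-- The point `F_{ω₀} ∘ ⋯ ∘ F_{ω_{n-1}} (q₁)` of `K_b`. -/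
noncomputable def codeApprox [NeZero b] (n : ℕ) (ω : ℕ → Fin (b + 2)) : K b :=
  ((FWord (List.ofFn fun i : Fin n => ω i) (.bdry 0) : Vertex b) : K b)

/-- The point of `K_b` with address `ω`: the only point in all the cells
`F_{ω₀} ∘ ⋯ ∘ F_{ω_{n-1}} (K_b)`. -/
noncomputable def code [NeZero b] (ω : ℕ → Fin (b + 2)) : K b :=
  limUnder atTop fun n => codeApprox n ω

/-- The self-similar probability measure `μ` on `K_b`: the distribution of the point whose address
is a sequence of independent, uniformly distributed digits. -/
noncomputable def mu (b : ℕ) [NeZero b] : Measure (K b) :=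
  (Measure.infinitePi fun _ : ℕ =>
    ProbabilityTheory.uniformOn (Set.univ : Set (Fin (b + 2)))).map code

theorem FWord_lipschitz [NeZero b] (w : List (Fin (b + 2))) :
    LipschitzWith ((r b).toNNReal ^ w.length) (FWord w) := by
  induction w with
  | nil => exact LipschitzWith.of_dist_le_mul fun p q => by simp [FWord]
  | cons i w ih =>
    rw [List.length_cons, pow_succ']
    exact (F_lipschitz i).comp ih

theorem codeApprox_cons [NeZero b] (n : ℕ) (i : Fin (b + 2)) (ω : ℕ → Fin (b + 2)) :
    codeApprox (n + 1) (consSeq i ω) = FK i (codeApprox n ω) := by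
  simp [codeApprox, List.ofFn_succ, FWord, FK_coe, consSeq]

theorem tendsto_codeApprox [NeZero b] (ω : ℕ → Fin (b + 2)) :
    Tendsto (fun n => codeApprox n ω) atTop (𝓝 (code ω)) := by
  obtain ⟨C, hC⟩ : ∃ C : ℝ, ∀ i : Fin (b + 2),
      dist (.bdry 0 : Vertex b) (F i (.bdry 0)) ≤ C :=
    ⟨∑ i : Fin (b + 2), dist (.bdry 0 : Vertex b) (F i (.bdry 0)), fun i =>
      Finset.single_le_sum (f := fun i => dist (.bdry 0 : Vertex b) (F i (.bdry 0)))
        (fun _ _ => dist_nonneg) (Finset.mem_univ i)⟩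
  have key : ∀ (w : List (Fin (b + 2))) (i : Fin (b + 2)) (p : Vertex b),
      FWord (w ++ [i]) p = FWord w (F i p) := by
    intro w i p
    induction w with
    | nil => rfl
    | cons a v ih => simp only [List.cons_append, FWord, ih]
  have hcs : CauchySeq fun n => codeApprox n ω := by
    refine cauchySeq_of_le_geometric (r b) C (by linarith [r_le_half (b := b)]) fun n => ?_
    have h1 : (List.ofFn fun i : Fin (n + 1) => ω i) = (List.ofFn fun i : Fin n => ω i) ++ [ω n] := by
      rw [List.ofFn_succ_last]
      rfl
    rw [codeApprox, codeApprox, UniformSpace.Completion.dist_eq, h1, key, mul_comm]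
    refine ((FWord_lipschitz _).dist_le_mul _ _).trans ?_
    rw [List.length_ofFn, NNReal.coe_pow, Real.coe_toNNReal _ r_nonneg]
    exact mul_le_mul_of_nonneg_left (hC _) (pow_nonneg r_nonneg _)
  exact tendsto_nhds_limUnder (cauchySeq_tendsto_of_complete hcs)

theorem code_cons [NeZero b] (i : Fin (b + 2)) (ω : ℕ → Fin (b + 2)) :
    code (consSeq i ω) = FK i (code ω) := by
  have h1 := (tendsto_add_atTop_iff_nat 1).2 (tendsto_codeApprox (consSeq i ω))
  simp only [codeApprox_cons] at h1
  exact tendsto_nhds_unique h1 (((continuous_FK i).tendsto _).comp (tendsto_codeApprox ω))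

theorem measurable_code [NeZero b] : Measurable (code : (ℕ → Fin (b + 2)) → K b) := by
  refine measurable_of_tendsto_metrizable (f := fun n => codeApprox n) (fun n => ?_)
    (tendsto_pi_nhds.2 fun ω => tendsto_codeApprox ω)
  have h : Measurable fun w : Fin n → Fin (b + 2) =>
      ((FWord (List.ofFn w) (.bdry 0) : Vertex b) : K b) := Measurable.of_discrete
  exact h.comp (measurable_pi_lambda _ fun i => measurable_pi_apply _)

instance [NeZero b] : IsProbabilityMeasure (mu b) :=
  Measure.isProbabilityMeasure_map measurable_code.aemeasurable

theorem infinitePi_cons {X : Type*} [MeasurableSpace X] (ν : Measure X) [IsProbabilityMeasure ν] :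
    Measure.infinitePi (fun _ : ℕ => ν) =
      (ν.prod (Measure.infinitePi fun _ : ℕ => ν)).map
        (fun p : X × (ℕ → X) => consSeq p.1 p.2) := by
  have hm : Measurable (fun p : X × (ℕ → X) => consSeq p.1 p.2) := by
    refine measurable_pi_lambda _ fun m => ?_
    cases m with
    | zero => exact measurable_fst
    | succ m => exact (measurable_pi_apply m).comp measurable_snd
  symm
  refine Measure.eq_infinitePi _ fun s t ht => ?_
  classical
  obtain ⟨N, hN⟩ : ∃ N, s ⊆ Finset.range (N + 1) :=
    ⟨s.sup id, fun i hi => Finset.mem_range.2 (Nat.lt_succ_of_le (Finset.le_sup (f := id) hi))⟩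
  let t' : ℕ → Set X := fun i => if i ∈ s then t i else Set.univ
  have ht' : ∀ i, MeasurableSet (t' i) := fun i => by
    by_cases h : i ∈ s
    · simpa [t', h] using ht i
    · simp [t', h]
  have hpi : Set.pi (s : Set ℕ) t = Set.pi (Finset.range (N + 1) : Set ℕ) t' := by
    ext x
    simp only [Set.mem_pi, Finset.mem_coe]
    constructor
    · intro h i _
      by_cases hi : i ∈ s
      · simpa [t', hi] using h i hi
      · simp [t', hi]
    · intro h i hi
      simpa [t', hi] using h i (hN hi)
  have hprod : ∏ i ∈ s, ν (t i) = ∏ i ∈ Finset.range (N + 1), ν (t' i) := by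
    rw [← Finset.prod_subset hN fun i _ hi => by simp [t', hi]]
    exact Finset.prod_congr rfl fun i hi => by simp [t', hi]
  rw [hpi, hprod, Measure.map_apply hm (.pi (Finset.countable_toSet _) fun i _ => ht' i)]
  have hpre : (fun p : X × (ℕ → X) => consSeq p.1 p.2) ⁻¹'
      Set.pi (Finset.range (N + 1) : Set ℕ) t' =
      t' 0 ×ˢ Set.pi (Finset.range N : Set ℕ) (fun i => t' (i + 1)) := by
    ext ⟨x, y⟩
    simp only [Set.mem_preimage, Set.mem_pi, Set.mem_prod, Finset.mem_coe, Finset.mem_range]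
    constructor
    · intro h
      exact ⟨h 0 (Nat.succ_pos _), fun i hi => h (i + 1) (Nat.succ_lt_succ hi)⟩
    · rintro ⟨h0, h1⟩ i hi
      cases i with
      | zero => exact h0
      | succ i => exact h1 i (Nat.lt_of_succ_lt_succ hi)
  rw [hpre, Measure.prod_prod, Measure.infinitePi_pi _ fun i _ => ht' (i + 1),
    Finset.prod_range_succ', mul_comm]

/-- The self-similarity of `μ`, which together with `μ(K_b) = 1` characterizes it. -/
theorem mu_apply [NeZero b] {A : Set (K b)} (hA : MeasurableSet A) :
    mu b A = ((b : ENNReal) + 2)⁻¹ * ∑ i : Fin (b + 2), mu b (FK i ⁻¹' A) := by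
  have hm : Measurable (fun p : Fin (b + 2) × (ℕ → Fin (b + 2)) => consSeq p.1 p.2) := by
    refine measurable_pi_lambda _ fun m => ?_
    cases m with
    | zero => exact measurable_fst
    | succ m => exact (measurable_pi_apply m).comp measurable_snd
  have hs : ∀ i : Fin (b + 2),
      ProbabilityTheory.uniformOn (Set.univ : Set (Fin (b + 2))) {i} = ((b : ENNReal) + 2)⁻¹ := by
    intro i
    rw [ProbabilityTheory.uniformOn_univ]
    simp
  conv_lhs => rw [mu, infinitePi_cons, Measure.map_map measurable_code hm,
    Measure.map_apply (measurable_code.comp hm) hA,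
    Measure.prod_apply ((measurable_code.comp hm) hA), lintegral_fintype]
  rw [Finset.mul_sum]
  refine Finset.sum_congr rfl fun i _ => ?_
  rw [hs, mul_comm, mu, Measure.map_apply measurable_code ((continuous_FK i).measurable hA)]
  congr 2
  ext ω
  simp [code_cons]

/-! ## Laplacian, normal derivatives, polynomials and monomials -/

/-- The restriction of a function on `K_b` to `V_*`. -/
noncomputable def restrict [NeZero b] (u : C(K b, ℝ)) : Vertex b → ℝ := fun p => u (p : K b)

/-- `u ∈ dom Δ` and `Δ u = f`. A function of finite energy on `V_*` is Hölder continuous in the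
resistance metric, so `dom 𝓔` consists of the continuous functions on `K_b` whose restriction to
`V_*` has finite energy. -/
def HasLaplacian [NeZero b] (u f : C(K b, ℝ)) : Prop :=
  FiniteEnergy (restrict u) ∧
    ∀ g : C(K b, ℝ), FiniteEnergy (restrict g) → g (q 0) = 0 → g (q 1) = 0 →
      energyForm (restrict u) (restrict g) = -∫ x, f x * g x ∂(mu b)

/-- The index of the map among the `F_i` that fixes `q_{k+1}`: `F_{b+1}` fixes `q₁`
and `F_{b+2}` fixes `q₂`. -/
def corner (k : Fin 2) : Fin (b + 2) := ⟨b + k.val, by omega⟩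

/-- The neighbour `x_m` in `G_m` of the boundary point with index `k`: the image of the other
boundary point under `m` applications of the map that fixes it. -/
def cornerNbr (k : Fin 2) (m : ℕ) : Vertex b := (F (corner k))^[m] (.bdry (Fin.rev k))

/-- The normal derivative of `u` at the boundary point `q k` exists and equals `c`. -/
def HasNormalDeriv [NeZero b] (u : C(K b, ℝ)) (k : Fin 2) (c : ℝ) : Prop :=
  Tendsto (fun m : ℕ => (r b ^ m)⁻¹ * (u (q k) - u (cornerNbr k m : Vertex b))) atTop (𝓝 c)

/-- The normal derivative of `u` at the boundary point `q k`. -/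
noncomputable def normalDeriv [NeZero b] (u : C(K b, ℝ)) (k : Fin 2) : ℝ :=
  limUnder atTop fun m : ℕ => (r b ^ m)⁻¹ * (u (q k) - u (cornerNbr k m : Vertex b))

/-- `v 0, …, v (j + 1)` are `u, Δ u, …, Δ^{j+1} u`, and the last of these vanishes. -/
def IsLaplacianChain [NeZero b] (j : ℕ) (u : C(K b, ℝ)) (v : ℕ → C(K b, ℝ)) : Prop :=
  v 0 = u ∧ (∀ m ≤ j, HasLaplacian (v m) (v (m + 1))) ∧ v (j + 1) = 0

/-- `u` is the monomial `P_{j,k+1}`: an element of `𝓗_j = {u : Δ^{j+1} u = 0}` with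
`Δ^m u (q₁) = δ_{mj} δ_{k+1,1}` and `∂_n Δ^m u (q₁) = δ_{mj} δ_{k+1,2}` for `0 ≤ m ≤ j`. -/
def IsMonomial [NeZero b] (j : ℕ) (k : Fin 2) (u : C(K b, ℝ)) : Prop :=
  ∃ v : ℕ → C(K b, ℝ), IsLaplacianChain j u v ∧
    ∀ m ≤ j, v m (q 0) = (if m = j ∧ k = 0 then 1 else 0) ∧
      HasNormalDeriv (v m) 0 (if m = j ∧ k = 1 then 1 else 0)

/-- The inner product of `L²(μ)`. -/
noncomputable def innerMu [NeZero b] (u v : C(K b, ℝ)) : ℝ := ∫ x, u x * v x ∂(mu b)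

end BubbleDiamond

namespace BubbleDiamond

variable {b : ℕ}

/-! ## The energy form -/

/-! The theorem is repeated integration by parts. For `u`, `v` in the domain of the Laplacian,
Green's formula says that `⟨u, Δv⟩ - ⟨Δu, v⟩` is a sum of boundary terms, values times normal
derivatives, at `q₁` and `q₂`. Uniqueness of monomials gives `ΔP_{j+1,k} = P_{jk}`, and for `j' ≥ 0`
both the value and the normal derivative of `P_{j'+1,k'}` vanish at `q₁`. Hence `⟨P_{jk}, P_{j'k'}⟩
= ⟨P_{jk}, ΔP_{j'+1,k'}⟩` equals `⟨ΔP_{jk}, P_{j'+1,k'}⟩` plus a term at `q₂` alone. Each such step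
lowers `j` and raises `j'`; after `j + 1` steps the inner product is zero because `ΔP_{0k} = 0`, and
the collected terms form the sum (`innerMu_monomial`).

Green's formula rests on tent functions, harmonic on the cells of level `m` and concentrated at one
boundary point. Pairing `u` with the `m`-th tent in the energy form gives exactly the `m`-th
difference quotient of the normal derivative (`energyForm_tent`), while the integral of the tent
against a continuous function tends to zero (`tendsto_innerMu_tentK`). Differences of tents at the
same point are admissible test functions, so the normal derivatives exist; subtracting from a
function its harmonic interpolant then yields `HasLaplacian.gauss_green`. The same formula, with the
resistance estimate, shows that a function with `Δu = 0` and zero value and normal derivative at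
`q₁` vanishes, whence uniqueness of monomials. -/

/-- The bilinear form of the graph energy of level `ℓ`. -/
noncomputable def graphForm (ℓ : ℕ) (f g : Vertex b → ℝ) : ℝ :=
  (r b ^ ℓ)⁻¹ * ∑ w : Fin ℓ → Fin (b + 2),
    (f (FWord (List.ofFn w) (.bdry 0)) - f (FWord (List.ofFn w) (.bdry 1))) *
      (g (FWord (List.ofFn w) (.bdry 0)) - g (FWord (List.ofFn w) (.bdry 1)))

theorem graphForm_self (ℓ : ℕ) (f : Vertex b → ℝ) : graphForm ℓ f f = graphEnergy ℓ f := by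
  simp only [graphForm, graphEnergy, sq]

theorem graphForm_comm (ℓ : ℕ) (f g : Vertex b → ℝ) : graphForm ℓ f g = graphForm ℓ g f := by
  simp only [graphForm, mul_comm]

theorem graphForm_add_right (ℓ : ℕ) (f g h : Vertex b → ℝ) :
    graphForm ℓ f (g + h) = graphForm ℓ f g + graphForm ℓ f h := by
  simp only [graphForm, ← mul_add, ← Finset.sum_add_distrib, Pi.add_apply]
  congr 1
  exact Finset.sum_congr rfl fun _ _ => by ring

theorem graphForm_smul_right (ℓ : ℕ) (c : ℝ) (f g : Vertex b → ℝ) :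
    graphForm ℓ f (c • g) = c * graphForm ℓ f g := by
  simp only [graphForm, Pi.smul_apply, smul_eq_mul]
  rw [mul_left_comm, Finset.mul_sum _ _ c]
  congr 1
  exact Finset.sum_congr rfl fun _ _ => by ring

theorem graphForm_polarization (ℓ : ℕ) (f g : Vertex b → ℝ) :
    graphForm ℓ f g = (graphEnergy ℓ (f + g) - graphEnergy ℓ (f - g)) / 4 := by
  simp only [graphForm, graphEnergy, ← mul_sub, ← Finset.sum_sub_distrib, Pi.add_apply,
    Pi.sub_apply]
  rw [mul_div_assoc, Finset.sum_div]
  congr 1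
  exact Finset.sum_congr rfl fun _ _ => by ring

theorem graphForm_zero (f g : Vertex b → ℝ) :
    graphForm 0 f g = (f (.bdry 0) - f (.bdry 1)) * (g (.bdry 0) - g (.bdry 1)) := by
  simp [graphForm, FWord]

theorem graphForm_succ (ℓ : ℕ) (f g : Vertex b → ℝ) :
    graphForm (ℓ + 1) f g = (r b)⁻¹ * ∑ i, graphForm ℓ (f ∘ F i) (g ∘ F i) := by
  simp only [graphForm]
  rw [← Finset.mul_sum, ← mul_assoc, pow_succ', mul_inv]
  congr 1
  rw [← (Fin.consEquiv (fun _ : Fin (ℓ + 1) => Fin (b + 2))).sum_comp, Fintype.sum_prod_type]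
  refine Finset.sum_congr rfl fun i _ => Finset.sum_congr rfl fun w _ => ?_
  simp [Fin.consEquiv, List.ofFn_succ, FWord]

theorem graphForm_const_right (ℓ : ℕ) (f : Vertex b → ℝ) (c : ℝ) :
    graphForm ℓ f (fun _ => c) = 0 := by
  simp [graphForm]

theorem graphForm_zero_right (ℓ : ℕ) (f : Vertex b → ℝ) : graphForm ℓ f 0 = 0 :=
  graphForm_const_right ℓ f 0

theorem graphEnergy_parallelogram (ℓ : ℕ) (f g : Vertex b → ℝ) :
    graphEnergy ℓ (f + g) + graphEnergy ℓ (f - g) =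
      2 * graphEnergy ℓ f + 2 * graphEnergy ℓ g := by
  have h1 := graphForm_self ℓ (f + g)
  have h2 := graphForm_polarization ℓ f g
  rw [graphForm_add_right, graphForm_comm ℓ _ f, graphForm_comm ℓ _ g, graphForm_add_right,
    graphForm_add_right, graphForm_comm ℓ g f, graphForm_self, graphForm_self] at h1
  linarith

theorem FiniteEnergy.add [NeZero b] {f g : Vertex b → ℝ} (hf : FiniteEnergy f)
    (hg : FiniteEnergy g) : FiniteEnergy (f + g) :=
  finiteEnergy_of_le (C := 2 * energy f + 2 * energy g) fun ℓ => by
    linarith [graphEnergy_parallelogram ℓ f g, graphEnergy_nonneg ℓ (f - g), hf.le ℓ, hg.le ℓ]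

theorem FiniteEnergy.smul {f : Vertex b → ℝ} (hf : FiniteEnergy f) (c : ℝ) :
    FiniteEnergy (c • f) := by
  refine ⟨c * (c * energy f), ?_⟩
  have h : ∀ ℓ, graphEnergy ℓ (c • f) = c * (c * graphEnergy ℓ f) := fun ℓ => by
    rw [← graphForm_self, graphForm_smul_right, graphForm_comm, graphForm_smul_right,
      graphForm_self]
  simp only [h]
  exact (hf.tendsto.const_mul c).const_mul c

theorem FiniteEnergy.sub [NeZero b] {f g : Vertex b → ℝ} (hf : FiniteEnergy f)
    (hg : FiniteEnergy g) : FiniteEnergy (f - g) := by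
  simpa [sub_eq_add_neg] using hf.add (hg.smul (-1))

theorem finiteEnergy_const (c : ℝ) : FiniteEnergy (fun _ : Vertex b => c) :=
  ⟨0, by simp [graphEnergy]⟩

/-- Polarization of a limit hides bilinearity. The graph forms are bilinear at every level, so each
algebraic rule for `energyForm` follows by uniqueness of limits. -/
theorem tendsto_graphForm [NeZero b] {f g : Vertex b → ℝ} (hf : FiniteEnergy f)
    (hg : FiniteEnergy g) :
    Tendsto (fun ℓ => graphForm ℓ f g) atTop (𝓝 (energyForm f g)) := by
  simp only [graphForm_polarization]
  exact ((hf.add hg).tendsto.sub (hf.sub hg).tendsto).div_const 4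

theorem energyForm_comm [NeZero b] {f g : Vertex b → ℝ} (hf : FiniteEnergy f)
    (hg : FiniteEnergy g) : energyForm f g = energyForm g f :=
  tendsto_nhds_unique (tendsto_graphForm hf hg) <| by
    simpa only [graphForm_comm _ f g] using tendsto_graphForm hg hf

theorem energyForm_add_right [NeZero b] {f g h : Vertex b → ℝ} (hf : FiniteEnergy f)
    (hg : FiniteEnergy g) (hh : FiniteEnergy h) :
    energyForm f (g + h) = energyForm f g + energyForm f h :=
  tendsto_nhds_unique (tendsto_graphForm hf (hg.add hh)) <| by
    simpa only [graphForm_add_right] using (tendsto_graphForm hf hg).add (tendsto_graphForm hf hh)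

theorem energyForm_smul_right [NeZero b] {f g : Vertex b → ℝ} (hf : FiniteEnergy f)
    (hg : FiniteEnergy g) (c : ℝ) : energyForm f (c • g) = c * energyForm f g :=
  tendsto_nhds_unique (tendsto_graphForm hf (hg.smul c)) <| by
    simpa only [graphForm_smul_right] using (tendsto_graphForm hf hg).const_mul c

theorem energyForm_sub_right [NeZero b] {f g h : Vertex b → ℝ} (hf : FiniteEnergy f)
    (hg : FiniteEnergy g) (hh : FiniteEnergy h) :
    energyForm f (g - h) = energyForm f g - energyForm f h := by
  have h1 := energyForm_add_right hf hg (hh.smul (-1))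
  rw [energyForm_smul_right hf hh] at h1
  rw [show g - h = g + (-1 : ℝ) • h by simp [sub_eq_add_neg], h1]
  ring

theorem energyForm_const_right [NeZero b] {f : Vertex b → ℝ} (hf : FiniteEnergy f) (c : ℝ) :
    energyForm f (fun _ => c) = 0 :=
  tendsto_nhds_unique (tendsto_graphForm hf (finiteEnergy_const c)) <| by
    simp [graphForm_const_right]

theorem energyForm_self [NeZero b] {f : Vertex b → ℝ} (hf : FiniteEnergy f) :
    energyForm f f = energy f :=
  tendsto_nhds_unique (tendsto_graphForm hf hf) <| by
    simpa only [graphForm_self] using hf.tendsto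

theorem sq_sub_le_dist_mul_energy [NeZero b] {f : Vertex b → ℝ} (hf : FiniteEnergy f)
    (p s : Vertex b) : (f p - f s) ^ 2 ≤ dist p s * energy f :=
  (resistance_isLeast p s).1.2 f hf

/-! ## Tent functions -/

/-- The function on `V_*` with given boundary values and restrictions `g i` to the cells. -/
def glue (c : Fin 2 → ℝ) (g : Fin (b + 2) → Vertex b → ℝ) : Vertex b → ℝ
  | .bdry k => c k
  | .node [] k => g (corner k) (.bdry (Fin.rev k))
  | .node (i :: w) k => g i (.node w k)

/-- The coefficients of the affine map `t ↦ (harmonicCoeff i).1 + (harmonicCoeff i).2 * t` that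
expresses the restriction of the harmonic function to the cell `i`. -/
noncomputable def harmonicCoeff (i : Fin (b + 2)) : ℝ × ℝ :=
  -- The path from `q₁` to `q₂` in `G_1` has resistances 1, 1/b, 1 in series, with total 1/r. A unit
  -- drop therefore splits into r, r/b = 1 - 2r and r.
  if i.val = b then (1 - r b, r b)
  else if i.val = b + 1 then (0, r b)
  else (r b, 1 - 2 * r b)

/-- The values at the new vertices of the harmonic function with boundary values `1` at `q₁` and
`0` at `q₂`. -/
noncomputable def harmonicNode : List (Fin (b + 2)) → Fin 2 → ℝ
  | [], k => if k = 0 then 1 - r b else r b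
  | i :: w, k => (harmonicCoeff i).1 + (harmonicCoeff i).2 * harmonicNode w k

/-- The harmonic function on `V_*` with boundary values `1` at `q₁` and `0` at `q₂`. -/
noncomputable def harmonic : Vertex b → ℝ
  | .bdry k => if k = 0 then 1 else 0
  | .node w k => harmonicNode w k

theorem harmonic_comp_F (i : Fin (b + 2)) (p : Vertex b) :
    harmonic (F i p) = (harmonicCoeff i).1 + (harmonicCoeff i).2 * harmonic p := by
  cases p with
  | node w k => rfl
  | bdry k =>
    fin_cases k <;> simp only [F, harmonicCoeff] <;> split_ifs <;>
      simp_all [harmonic, harmonicNode]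
    all_goals ring

theorem sum_cells (φ : Fin (b + 2) → ℝ) :
    ∑ i, φ i = ∑ i : Fin b, φ i.castSucc.castSucc + φ (corner 0) + φ (corner 1) := by
  rw [Fin.sum_univ_castSucc, Fin.sum_univ_castSucc]
  rfl

/-- On each cell the harmonic function is an affine image of itself, so by induction the cell
contributes its slope times the drop of `u` across it. Since `b(1 - 2r) = r`, the contributions
telescope to the drop from `q₁` to `q₂`. -/
theorem graphForm_harmonic [NeZero b] (ℓ : ℕ) (u : Vertex b → ℝ) :
    graphForm ℓ u harmonic = u (.bdry 0) - u (.bdry 1) := by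
  induction ℓ generalizing u with
  | zero => simp [graphForm_zero, harmonic]
  | succ ℓ ih =>
    have h : ∀ i : Fin (b + 2), graphForm ℓ (u ∘ F i) (harmonic ∘ F i) =
        (harmonicCoeff i).2 * (u (F i (.bdry 0)) - u (F i (.bdry 1))) := fun i => by
      have h1 : (harmonic ∘ F i : Vertex b → ℝ) =
          (fun _ => (harmonicCoeff i).1) + (harmonicCoeff i).2 • harmonic := by
        ext p
        simp [harmonic_comp_F]
      rw [h1, graphForm_add_right, graphForm_smul_right, graphForm_const_right, ih]
      simp
    have hmid : ∀ i : Fin b, (harmonicCoeff i.castSucc.castSucc).2 *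
        (u (F i.castSucc.castSucc (.bdry 0)) - u (F i.castSucc.castSucc (.bdry 1))) =
        (1 - 2 * r b) * (u (.node [] 0) - u (.node [] 1)) := fun i => by
      have h1 : (i : ℕ) ≠ b := i.2.ne
      have h2 : (i : ℕ) ≠ b + 1 := by have := i.2; omega
      simp [harmonicCoeff, F, h1, h2]
    rw [graphForm_succ, Finset.sum_congr rfl fun i _ => h i, sum_cells,
      Finset.sum_congr rfl fun i _ => hmid i]
    simp only [Finset.sum_const, Finset.card_univ, Fintype.card_fin, nsmul_eq_mul]
    have hb : 0 < (b : ℝ) := by exact_mod_cast Nat.pos_of_ne_zero (NeZero.ne b)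
    simp [harmonicCoeff, corner, F]
    generalize u (.bdry 0) = x, u (.node [] 0) = p, u (.node [] 1) = s, u (.bdry 1) = y
    unfold r
    field_simp
    ring

/-- The function on `V_*` that is harmonic on every cell of level `m`, equals `1` at the boundary
point with index `k` and vanishes at the other vertices of `G_m`. -/
noncomputable def tent (k : Fin 2) : ℕ → Vertex b → ℝ
  | 0 => fun p => if k = 0 then harmonic p else 1 - harmonic p
  | m + 1 =>
    glue (fun i => if i = k then 1 else 0) fun i p => if i = corner k then tent k m p else 0

theorem tent_bdry (k : Fin 2) (m : ℕ) (i : Fin 2) :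
    tent k m (.bdry i : Vertex b) = if i = k then 1 else 0 := by
  cases m with
  | zero => fin_cases k <;> fin_cases i <;> simp [tent, harmonic]
  | succ m => rfl

theorem tent_succ_F (k : Fin 2) (m : ℕ) (i : Fin (b + 2)) (p : Vertex b) :
    tent k (m + 1) (F i p) = if i = corner k then tent k m p else 0 := by
  -- The gluing is consistent because the tent is zero at both new vertices of `G_1`: in the corner
  -- cell the new vertex is the opposite boundary point, where `tent k m` vanishes.
  have hn : ∀ j : Fin 2, tent k (m + 1) (.node [] j : Vertex b) = 0 := fun j => by
    simp only [tent, glue]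
    split_ifs with h
    · have : j = k := by
        simp only [corner, Fin.mk.injEq] at h
        exact Fin.ext (by omega)
      subst this
      rw [tent_bdry]
      fin_cases j <;> simp
    · rfl
  cases p with
  | node w j => rfl
  | bdry j =>
    rw [tent_bdry]
    by_cases h1 : i.val = b
    · obtain rfl : i = corner 0 := Fin.ext h1
      fin_cases k <;> fin_cases j <;> simp [F, corner, tent_bdry] <;> exact hn _
    · by_cases h2 : i.val = b + 1
      · obtain rfl : i = corner 1 := Fin.ext h2
        fin_cases k <;> fin_cases j <;> simp [F, corner, tent_bdry] <;> exact hn _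
      · have h3 : i ≠ corner k := by
          rintro rfl
          fin_cases k <;> simp [corner] at h1 h2
        simp [F, h1, h2, h3, hn]

/-- Only the corner cell of level `m` contributes. There the tent is the harmonic function, or one
minus it, so the pairing is constant from level `m` on and is the rescaled drop of `u` across that
cell. -/
theorem graphForm_tent [NeZero b] (k : Fin 2) (m ℓ : ℕ) (u : Vertex b → ℝ) :
    graphForm (m + ℓ) u (tent k m) =
      (r b ^ m)⁻¹ * (u (.bdry k) - u (cornerNbr k m)) := by
  induction m generalizing u with
  | zero =>
    fin_cases k
    · have h : (tent 0 0 : Vertex b → ℝ) = harmonic := by ext; simp [tent]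
      simp [h, graphForm_harmonic, cornerNbr]
    · have h : (tent 1 0 : Vertex b → ℝ) =
          (fun _ => 1) + (-1 : ℝ) • harmonic := by ext; simp [tent, sub_eq_add_neg]
      simp only [Fin.mk_one, h, graphForm_add_right, graphForm_smul_right,
        graphForm_const_right, zero_add, graphForm_harmonic]
      simp [cornerNbr]
  | succ m ih =>
    have h : ∀ i : Fin (b + 2), (tent k (m + 1) ∘ F i : Vertex b → ℝ) =
        if i = corner k then tent k m else 0 := fun i => by
      ext p
      rw [Function.comp_apply, tent_succ_F]
      split_ifs <;> rfl
    have hc : F (corner k) (.bdry k) = (.bdry k : Vertex b) := by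
      fin_cases k <;> simp [F, corner]
    rw [show m + 1 + ℓ = m + ℓ + 1 by omega, graphForm_succ,
      Finset.sum_eq_single (corner k) (fun i _ hi => by rw [h, if_neg hi, graphForm_zero_right])
        (by simp), h, if_pos rfl, ih, pow_succ', mul_inv, mul_assoc]
    simp only [Function.comp_apply, hc, cornerNbr, Function.iterate_succ_apply']

theorem finiteEnergy_tent [NeZero b] (k : Fin 2) (m : ℕ) :
    FiniteEnergy (tent k m : Vertex b → ℝ) := by
  refine ⟨(r b ^ m)⁻¹ * (tent k m (.bdry k : Vertex b) - tent k m (cornerNbr k m : Vertex b)),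
    (tendsto_add_atTop_iff_nat m).1 ?_⟩
  simp only [← graphForm_self, add_comm _ m, graphForm_tent, tendsto_const_nhds]

theorem energyForm_tent [NeZero b] {u : Vertex b → ℝ} (hu : FiniteEnergy u) (k : Fin 2) (m : ℕ) :
    energyForm u (tent k m) = (r b ^ m)⁻¹ * (u (.bdry k) - u (cornerNbr k m)) := by
  have h := (tendsto_add_atTop_iff_nat m).2 (tendsto_graphForm hu (finiteEnergy_tent k m))
  simp only [add_comm _ m, graphForm_tent] at h
  exact tendsto_nhds_unique h tendsto_const_nhds

/-! ## Compactness, extension of functions of finite energy and self-similar integration -/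

theorem exists_F_eq (p : Vertex b) : ∃ i s, F i s = p := by
  cases p with
  | bdry k => exact ⟨corner k, .bdry k, by fin_cases k <;> simp [F, corner]⟩
  | node w k =>
    cases w with
    | nil => exact ⟨corner k, .bdry (Fin.rev k), by fin_cases k <;> simp [F, corner]⟩
    | cons i w => exact ⟨i, .node w k, rfl⟩

theorem exists_FWord_eq (n : ℕ) (p : Vertex b) :
    ∃ (w : Fin n → Fin (b + 2)) (s : Vertex b), FWord (List.ofFn w) s = p := by
  induction n generalizing p with
  | zero => exact ⟨Fin.elim0, p, rfl⟩
  | succ n ih =>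
    obtain ⟨i, s, rfl⟩ := exists_F_eq p
    obtain ⟨w, t, rfl⟩ := ih s
    exact ⟨Fin.cons i w, t, by simp [List.ofFn_succ, FWord]⟩

theorem exists_dist_bdry_le [NeZero b] :
    ∃ D : ℝ, ∀ p : Vertex b, dist p (.bdry 0) ≤ D := by
  set C : ℝ := dist (.bdry 1 : Vertex b) (.bdry 0) +
      ∑ k, dist (.node [] k : Vertex b) (.bdry 0) +
      ∑ i, dist (F i (.bdry 0) : Vertex b) (.bdry 0) with hC
  have hk : ∀ k, dist (.node [] k : Vertex b) (.bdry 0) ≤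
      ∑ k, dist (.node [] k : Vertex b) (.bdry 0) := fun k =>
    Finset.single_le_sum (f := fun k => dist (.node [] k : Vertex b) (.bdry 0))
      (fun _ _ => dist_nonneg) (Finset.mem_univ k)
  have hi : ∀ i, dist (F i (.bdry 0) : Vertex b) (.bdry 0) ≤
      ∑ i, dist (F i (.bdry 0) : Vertex b) (.bdry 0) := fun i =>
    Finset.single_le_sum (f := fun i => dist (F i (.bdry 0) : Vertex b) (.bdry 0))
      (fun _ _ => dist_nonneg) (Finset.mem_univ i)
  have hk0 := (dist_nonneg).trans (hk 0)
  have hi0 := (dist_nonneg).trans (hi 0)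
  have hb0 : 0 ≤ dist (.bdry 1 : Vertex b) (.bdry 0) := dist_nonneg
  -- The bound reproduces itself under a contraction with ratio `r ≤ 1/2`: `r * (2 * C) + C ≤ 2 *
  -- C`.
  refine ⟨2 * C, fun p => ?_⟩
  cases p with
  | bdry k => fin_cases k <;> simp <;> linarith
  | node w k =>
    induction w with
    | nil => linarith [hk k]
    | cons i w ih =>
      have h1 := (F_lipschitz i).dist_le_mul (.node w k) (.bdry 0)
      rw [Real.coe_toNNReal _ r_nonneg] at h1
      have h2 := dist_triangle (F i (.node w k)) (F i (.bdry 0)) (.bdry 0)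
      have h3 : r b * dist (.node w k : Vertex b) (.bdry 0) ≤ 1 / 2 * (2 * C) :=
        mul_le_mul r_le_half ih dist_nonneg (by norm_num)
      change dist (F i (.node w k)) _ ≤ _
      linarith [hi i]

/-- The finitely many cells of level `n` cover `V_*`, and each lies within `r ^ n * D` of its image
of `q₁`. This makes `K_b` compact, hence continuous functions bounded and integrable. -/
theorem totallyBounded_vertex [NeZero b] : TotallyBounded (Set.univ : Set (Vertex b)) := by
  obtain ⟨D, hD⟩ := exists_dist_bdry_le (b := b)
  refine Metric.totallyBounded_iff.2 fun ε hε => ?_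
  have hlim : Tendsto (fun n => r b ^ n * D) atTop (𝓝 0) := by
    simpa using (tendsto_pow_atTop_nhds_zero_of_lt_one r_nonneg
      (by linarith [r_le_half (b := b)])).mul_const D
  obtain ⟨n, hn⟩ := (hlim.eventually_lt_const hε).exists
  refine ⟨Set.range fun w : Fin n → Fin (b + 2) => FWord (List.ofFn w) (.bdry 0),
    Set.finite_range _, fun p _ => ?_⟩
  obtain ⟨w, s, rfl⟩ := exists_FWord_eq n p
  simp only [Set.mem_iUnion, Set.mem_range, exists_prop, exists_exists_eq_and, Metric.mem_ball]
  refine ⟨w, ((FWord_lipschitz _).dist_le_mul _ _).trans_lt (lt_of_le_of_lt ?_ hn)⟩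
  rw [List.length_ofFn, NNReal.coe_pow, Real.coe_toNNReal _ r_nonneg]
  exact mul_le_mul_of_nonneg_left (hD s) (pow_nonneg r_nonneg _)

instance [NeZero b] : CompactSpace (K b) := by
  refine ⟨isCompact_iff_totallyBounded_isComplete.2 ⟨?_, isComplete_univ⟩⟩
  have h := (totallyBounded_vertex.image
    (UniformSpace.Completion.uniformContinuous_coe (Vertex b))).closure
  rwa [Set.image_univ, UniformSpace.Completion.denseRange_coe.closure_range] at h

theorem integrable_continuousMap [NeZero b] (f : C(K b, ℝ)) : Integrable f (mu b) :=
  f.continuous.integrable_of_hasCompactSupport (HasCompactSupport.of_compactSpace _)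

theorem innerMu_comm [NeZero b] (f g : C(K b, ℝ)) : innerMu f g = innerMu g f := by
  simp only [innerMu, mul_comm]

theorem innerMu_sub_right [NeZero b] (f g h : C(K b, ℝ)) :
    innerMu f (g - h) = innerMu f g - innerMu f h := by
  simp only [innerMu, ContinuousMap.sub_apply, mul_sub]
  exact integral_sub (integrable_continuousMap (f * g)) (integrable_continuousMap (f * h))

theorem innerMu_smul_right [NeZero b] (f g : C(K b, ℝ)) (c : ℝ) :
    innerMu f (c • g) = c * innerMu f g := by
  simp only [innerMu, ContinuousMap.smul_apply, smul_eq_mul, mul_left_comm _ c]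
  exact integral_const_mul c _

theorem FiniteEnergy.uniformContinuous [NeZero b] {f : Vertex b → ℝ} (hf : FiniteEnergy f) :
    UniformContinuous f := by
  refine Metric.uniformContinuous_iff.2 fun ε hε => ?_
  have hE := energy_nonneg hf
  -- The resistance estimate makes `f` Hölder of exponent 1/2; the summand 1 covers zero energy.
  refine ⟨ε ^ 2 / (energy f + 1), by positivity, fun {p s} h => ?_⟩
  rw [lt_div_iff₀ (by positivity)] at h
  rw [Real.dist_eq]
  refine abs_lt_of_sq_lt_sq ?_ hε.le
  nlinarith [sq_sub_le_dist_mul_energy hf p s, dist_nonneg (x := p) (y := s)]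

/-- Test functions for the Laplacian live on `K_b`, whereas tents are built on `V_*`; this extension
connects the two. -/
theorem FiniteEnergy.exists_restrict_eq [NeZero b] {f : Vertex b → ℝ} (hf : FiniteEnergy f) :
    ∃ u : C(K b, ℝ), restrict u = f :=
  ⟨⟨UniformSpace.Completion.extension f, UniformSpace.Completion.continuous_extension⟩,
    funext fun p => UniformSpace.Completion.extension_coe hf.uniformContinuous p⟩

theorem restrict_injective [NeZero b] {u v : C(K b, ℝ)} (h : restrict u = restrict v) :
    u = v :=
  ContinuousMap.ext <| congrFun <|
    UniformSpace.Completion.denseRange_coe.equalizer u.continuous v.continuous h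

theorem mu_eq_smul_sum [NeZero b] :
    mu b = ((b : ENNReal) + 2)⁻¹ • Measure.sum fun i : Fin (b + 2) => (mu b).map (FK i) := by
  ext A hA
  rw [Measure.smul_apply, Measure.sum_apply _ hA, tsum_fintype, smul_eq_mul]
  conv_lhs => rw [mu_apply hA]
  simp_rw [Measure.map_apply (continuous_FK _).measurable hA]

theorem integral_mu_eq [NeZero b] (f : C(K b, ℝ)) :
    ∫ x, f x ∂(mu b) = ((b : ℝ) + 2)⁻¹ * ∑ i, ∫ x, f (FK i x) ∂(mu b) := by
  have hf : Integrable f (Measure.sum fun i : Fin (b + 2) => (mu b).map (FK i)) :=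
    f.continuous.integrable_of_hasCompactSupport (HasCompactSupport.of_compactSpace _)
  conv_lhs => rw [mu_eq_smul_sum, integral_smul_measure, integral_sum_measure hf, tsum_fintype]
  have hc : ((b : ENNReal) + 2)⁻¹.toReal = ((b : ℝ) + 2)⁻¹ := by
    rw [ENNReal.toReal_inv, ENNReal.toReal_add (by simp) (by simp)]
    simp
  rw [hc, smul_eq_mul]
  congr 1
  exact Finset.sum_congr rfl fun i _ =>
    integral_map (continuous_FK i).aemeasurable f.continuous.aestronglyMeasurable

/-! ### Tent functions on the fractal and the decay of their integrals -/

/-- The continuous extension of the tent function. -/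
noncomputable def tentK [NeZero b] (k : Fin 2) (m : ℕ) : C(K b, ℝ) :=
  (finiteEnergy_tent k m).exists_restrict_eq.choose

theorem restrict_tentK [NeZero b] (k : Fin 2) (m : ℕ) :
    restrict (tentK k m : C(K b, ℝ)) = tent k m :=
  (finiteEnergy_tent k m).exists_restrict_eq.choose_spec

theorem tentK_succ_FK [NeZero b] (k : Fin 2) (m : ℕ) (i : Fin (b + 2)) (x : K b) :
    tentK k (m + 1) (FK i x) = if i = corner k then tentK k m x else 0 := by
  have h : ∀ m p, tentK k m ((p : Vertex b) : K b) = tent k m p :=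
    fun m => congrFun (restrict_tentK k m)
  induction x using UniformSpace.Completion.induction_on with
  | hp =>
    refine isClosed_eq ((tentK k (m + 1)).continuous.comp (continuous_FK i)) ?_
    split_ifs
    · exact (tentK k m).continuous
    · exact continuous_const
  | ih p => rw [FK_coe, h, h, tent_succ_F]

theorem integral_abs_tentK_succ [NeZero b] (k : Fin 2) (m : ℕ) :
    ∫ x, |tentK k (m + 1) x| ∂(mu b) = ((b : ℝ) + 2)⁻¹ * ∫ x, |tentK k m x| ∂(mu b) := by
  have h := integral_mu_eq |(tentK k (m + 1) : C(K b, ℝ))|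
  simp only [ContinuousMap.abs_apply, tentK_succ_FK] at h
  rw [h, Finset.sum_eq_single (corner k) (fun i _ hi => by simp [hi]) (by simp)]
  simp

/-- By self-similarity of the measure the `L¹` norm of the tent shrinks by the factor `1/(b+2)` at
each level, and `f` is bounded. -/
theorem tendsto_innerMu_tentK [NeZero b] (k : Fin 2) (f : C(K b, ℝ)) :
    Tendsto (fun m => innerMu f (tentK k m)) atTop (𝓝 0) := by
  have h : ∀ m, ∫ x, |tentK k m x| ∂(mu b) =
      (((b : ℝ) + 2)⁻¹) ^ m * ∫ x, |tentK k 0 x| ∂(mu b) := fun m => by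
    induction m with
    | zero => simp
    | succ m ih => rw [integral_abs_tentK_succ, ih, pow_succ']; ring
  have hlim : Tendsto (fun m => ‖f‖ * ((((b : ℝ) + 2)⁻¹) ^ m * ∫ x, |tentK k 0 x| ∂(mu b)))
      atTop (𝓝 0) := by
    have hlt : ((b : ℝ) + 2)⁻¹ < 1 := inv_lt_one_of_one_lt₀ (by linarith [b.cast_nonneg (α := ℝ)])
    simpa using ((tendsto_pow_atTop_nhds_zero_of_lt_one (by positivity) hlt).mul_const
      (∫ x, |tentK k 0 x| ∂(mu b))).const_mul ‖f‖
  refine squeeze_zero_norm (fun m => ?_) hlim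
  rw [← h, ← integral_const_mul, innerMu]
  refine norm_integral_le_of_norm_le
    ((integrable_continuousMap |(tentK k m : C(K b, ℝ))|).const_mul ‖f‖) (.of_forall fun x => ?_)
  rw [norm_mul]
  exact mul_le_mul_of_nonneg_right (f.norm_coe_le_norm x) (norm_nonneg _)

/-! ## The Gauss–Green formula -/

/-- The difference of the tents of levels `m` and 0 vanishes on the boundary, so it may be tested
against. This expresses the `m`-th difference quotient as a constant minus `innerMu f (tentK k m)`,
which tends to zero. -/
theorem HasLaplacian.hasNormalDeriv [NeZero b] {u f : C(K b, ℝ)} (h : HasLaplacian u f)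
    (k : Fin 2) :
    HasNormalDeriv u k (energyForm (restrict u) (tent k 0) + innerMu f (tentK k 0)) := by
  have hE : ∀ m, energyForm (restrict u) (tent k 0) + innerMu f (tentK k 0) -
      innerMu f (tentK k m) = energyForm (restrict u) (tent k m) := fun m => by
    have hr : restrict (tentK k m - tentK k 0 : C(K b, ℝ)) = tent k m - tent k 0 := by
      rw [← restrict_tentK, ← restrict_tentK]; rfl
    have hq : ∀ i, (tentK k m - tentK k 0 : C(K b, ℝ)) (q i) = 0 := fun i =>
      (congrFun hr (.bdry i)).trans (by simp [tent_bdry])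
    have h1 : _ = -innerMu _ _ := h.2 (tentK k m - tentK k 0)
      (hr ▸ (finiteEnergy_tent k m).sub (finiteEnergy_tent k 0)) (hq 0) (hq 1)
    rw [hr, energyForm_sub_right h.1 (finiteEnergy_tent k m) (finiteEnergy_tent k 0),
      innerMu_sub_right] at h1
    linarith
  have hlim := (tendsto_innerMu_tentK k f).const_sub
    (energyForm (restrict u) (tent k 0) + innerMu f (tentK k 0))
  rw [sub_zero] at hlim
  exact hlim.congr fun m => (hE m).trans (energyForm_tent h.1 k m)

/-- Subtracting from `g` its harmonic interpolant, a combination of the two tents of level 0, leaves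
an admissible test function. The interpolant accounts for the boundary terms, by the explicit normal
derivatives of `HasLaplacian.hasNormalDeriv`. -/
theorem HasLaplacian.gauss_green [NeZero b] {u f g : C(K b, ℝ)} (h : HasLaplacian u f)
    (hg : FiniteEnergy (restrict g)) {c : Fin 2 → ℝ} (hc : ∀ k, HasNormalDeriv u k (c k)) :
    energyForm (restrict u) (restrict g) =
      -innerMu f g + (g (q 0) * c 0 + g (q 1) * c 1) := by
  have hck := fun k => tendsto_nhds_unique (hc k) (h.hasNormalDeriv k)
  have ht := fun k => finiteEnergy_tent (b := b) k 0
  have h0 := (ht 0).smul (g (q 0))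
  have h1 := (ht 1).smul (g (q 1))
  have hr : restrict (g - g (q 0) • tentK 0 0 - g (q 1) • tentK 1 0) =
      restrict g - g (q 0) • tent 0 0 - g (q 1) • tent 1 0 := by
    rw [← restrict_tentK, ← restrict_tentK]; rfl
  have hq : ∀ i, (g - g (q 0) • tentK 0 0 - g (q 1) • tentK 1 0 : C(K b, ℝ)) (q i) = 0 := fun i =>
    (congrFun hr (.bdry i)).trans (by fin_cases i <;> simp [tent_bdry, restrict, q])
  have h2 : _ = -innerMu _ _ := h.2 _ (hr ▸ (hg.sub h0).sub h1) (hq 0) (hq 1)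
  rw [hr, energyForm_sub_right h.1 (hg.sub h0) h1, energyForm_sub_right h.1 hg h0,
    energyForm_smul_right h.1 (ht 0), energyForm_smul_right h.1 (ht 1), innerMu_sub_right,
    innerMu_sub_right, innerMu_smul_right, innerMu_smul_right] at h2
  rw [hck 0, hck 1]
  linarith

/-- The Gauss–Green formula is applied to both orders of the pair and the energies cancel by
symmetry. -/
theorem HasLaplacian.green [NeZero b] {u f v g : C(K b, ℝ)} (hu : HasLaplacian u f)
    (hv : HasLaplacian v g) {c d : Fin 2 → ℝ} (hc : ∀ k, HasNormalDeriv u k (c k))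
    (hd : ∀ k, HasNormalDeriv v k (d k)) :
    innerMu u g = innerMu f v + (u (q 0) * d 0 - v (q 0) * c 0) +
      (u (q 1) * d 1 - v (q 1) * c 1) := by
  have h1 := hu.gauss_green hv.1 hc
  have h2 := hv.gauss_green hu.1 hd
  rw [energyForm_comm hu.1 hv.1, h2, innerMu_comm g] at h1
  linarith

/-! ## Uniqueness of monomials -/

theorem HasLaplacian.sub [NeZero b] {u f v g : C(K b, ℝ)} (hu : HasLaplacian u f)
    (hv : HasLaplacian v g) : HasLaplacian (u - v) (f - g) := by
  have hr : restrict (u - v) = restrict u - restrict v := rfl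
  refine ⟨hr ▸ hu.1.sub hv.1, fun w hw h0 h1 => ?_⟩
  rw [hr, energyForm_comm (hu.1.sub hv.1) hw, energyForm_sub_right hw hu.1 hv.1,
    energyForm_comm hw hu.1, energyForm_comm hw hv.1, hu.2 w hw h0 h1, hv.2 w hw h0 h1]
  change -innerMu f w - -innerMu g w = -innerMu (f - g) w
  rw [innerMu_comm (f - g), innerMu_sub_right, innerMu_comm w, innerMu_comm w]
  ring

theorem HasNormalDeriv.sub [NeZero b] {u v : C(K b, ℝ)} {k : Fin 2} {c d : ℝ}
    (hu : HasNormalDeriv u k c) (hv : HasNormalDeriv v k d) :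
    HasNormalDeriv (u - v) k (c - d) :=
  (Tendsto.sub hu hv).congr fun m => by simp only [ContinuousMap.sub_apply]; ring

/-- Testing with the constant 1 forces the normal derivative at `q₂` to vanish too. Testing with `u`
itself then gives zero energy, and by the resistance estimate `u` is constant. -/
theorem HasLaplacian.eq_zero [NeZero b] {u : C(K b, ℝ)} (h : HasLaplacian u 0)
    (h0 : u (q 0) = 0) (hd : HasNormalDeriv u 0 0) : u = 0 := by
  obtain ⟨c, hc⟩ : ∃ c, HasNormalDeriv u 1 c := ⟨_, h.hasNormalDeriv 1⟩
  have hcd : ∀ k, HasNormalDeriv u k (![0, c] k) := fun k => by fin_cases k <;> simpa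
  have hconst : energyForm (restrict u) (restrict (.const (K b) 1)) = 0 :=
    energyForm_const_right h.1 1
  have h1 := h.gauss_green (g := .const _ 1) (finiteEnergy_const 1) hcd
  rw [hconst] at h1
  have h2 := h.gauss_green h.1 hcd
  obtain rfl : c = 0 := by simpa [innerMu] using h1.symm
  have h2 : energy (restrict u) = 0 := by simpa [energyForm_self h.1, innerMu] using h2
  refine restrict_injective (funext fun p => ?_)
  have h3 := sq_sub_le_dist_mul_energy h.1 p (.bdry 0)
  have h4 : restrict u (.bdry 0) = 0 := h0
  rw [h2, h4, mul_zero, sub_zero] at h3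
  exact pow_eq_zero_iff two_ne_zero |>.1 (le_antisymm h3 (sq_nonneg _))

theorem HasLaplacian.unique [NeZero b] {u v f : C(K b, ℝ)} (hu : HasLaplacian u f)
    (hv : HasLaplacian v f) (h0 : u (q 0) = v (q 0)) {c : ℝ} (hcu : HasNormalDeriv u 0 c)
    (hcv : HasNormalDeriv v 0 c) : u = v :=
  sub_eq_zero.1 <| HasLaplacian.eq_zero (by simpa using hu.sub hv) (by simp [h0])
    (by simpa using hcu.sub hcv)

theorem IsMonomial.unique [NeZero b] {j : ℕ} {k : Fin 2} {u u' : C(K b, ℝ)}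
    (hu : IsMonomial j k u) (hu' : IsMonomial j k u') : u = u' := by
  obtain ⟨v, ⟨rfl, hv, hvj⟩, hb⟩ := hu
  obtain ⟨v', ⟨rfl, hv', hvj'⟩, hb'⟩ := hu'
  -- The chains agree at index `j + 1`, where both are zero. Reversing the index turns the descent
  -- to index 0 into an ordinary induction.
  have h : ∀ n ≤ j + 1, v (j + 1 - n) = v' (j + 1 - n) := fun n => by
    induction n with
    | zero => intro _; simp [hvj, hvj']
    | succ n ih =>
      intro hn
      have h1 := ih (by omega)
      rw [show j + 1 - n = j + 1 - (n + 1) + 1 by omega] at h1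
      have hm : j + 1 - (n + 1) ≤ j := by omega
      exact (h1 ▸ hv _ hm).unique (hv' _ hm) ((hb _ hm).1.trans (hb' _ hm).1.symm) (hb _ hm).2
        (hb' _ hm).2
  simpa using h (j + 1) le_rfl

/-! ### The Laplacian on monomials and their inner products -/

theorem IsMonomial.hasLaplacian_zero [NeZero b] {k : Fin 2} {u : C(K b, ℝ)}
    (hu : IsMonomial 0 k u) : HasLaplacian u 0 := by
  obtain ⟨v, ⟨rfl, hv, h1⟩, -⟩ := hu
  exact h1 ▸ hv 0 le_rfl

/-- Dropping the first member of the chain of `u` leaves the chain of a monomial of index `j`, which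
uniqueness identifies with `u'`. -/
theorem IsMonomial.hasLaplacian_succ [NeZero b] {j : ℕ} {k : Fin 2} {u u' : C(K b, ℝ)}
    (hu : IsMonomial (j + 1) k u) (hu' : IsMonomial j k u') : HasLaplacian u u' := by
  obtain ⟨v, ⟨rfl, hv, hj⟩, hb⟩ := hu
  have h : IsMonomial j k (v 1) :=
    ⟨fun m => v (m + 1), ⟨rfl, fun m hm => hv (m + 1) (by omega), hj⟩, fun m hm => by
      simpa using hb (m + 1) (by omega)⟩
  exact h.unique hu' ▸ hv 0 (Nat.zero_le _)

theorem IsMonomial.exists_hasLaplacian [NeZero b] {j : ℕ} {k : Fin 2} {u : C(K b, ℝ)}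
    (hu : IsMonomial j k u) : ∃ f, HasLaplacian u f := by
  obtain ⟨v, ⟨rfl, hv, -⟩, -⟩ := hu
  exact ⟨_, hv 0 (Nat.zero_le _)⟩

/-- This removes the boundary term at `q₁` from Green's formula. -/
theorem IsMonomial.succ_bdry [NeZero b] {j : ℕ} {k : Fin 2} {u : C(K b, ℝ)}
    (hu : IsMonomial (j + 1) k u) : u (q 0) = 0 ∧ HasNormalDeriv u 0 0 := by
  obtain ⟨v, ⟨rfl, -, -⟩, hb⟩ := hu
  simpa using hb 0 (Nat.zero_le _)

theorem IsMonomial.hasNormalDeriv [NeZero b] {j : ℕ} {k : Fin 2} {u : C(K b, ℝ)}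
    (hu : IsMonomial j k u) (i : Fin 2) : HasNormalDeriv u i (normalDeriv u i) := by
  obtain ⟨f, hf⟩ := hu.exists_hasLaplacian
  exact tendsto_nhds_limUnder ⟨_, hf.hasNormalDeriv i⟩

/-- Integration by parts moves one Laplacian between the factors of an inner product of
monomials. -/
theorem IsMonomial.innerMu_eq [NeZero b] {j j' : ℕ} {k k' : Fin 2} {u f v g : C(K b, ℝ)}
    (hu : IsMonomial j k u) (hf : HasLaplacian u f) (hv : IsMonomial (j' + 1) k' v)
    (hg : HasLaplacian v g) :
    innerMu u g = innerMu f v +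
      (u (q 1) * normalDeriv v 1 - v (q 1) * normalDeriv u 1) := by
  have h := hf.green hg hu.hasNormalDeriv hv.hasNormalDeriv
  have h0 : normalDeriv v 0 = 0 := hv.succ_bdry.2.limUnder_eq
  rwa [hv.succ_bdry.1, h0, mul_zero, zero_mul, sub_zero, add_zero] at h

/-- Induction on `j` with `j'` free, since each integration by parts trades one index for the other.
Arbitrary `k` and `k'` cover all three formulas at once. -/
theorem innerMu_monomial [NeZero b] {P : ℕ → Fin 2 → C(K b, ℝ)}
    (hP : ∀ j k, IsMonomial j k (P j k)) (k k' : Fin 2) (j j' : ℕ) :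
    innerMu (P j k) (P j' k') = ∑ l ∈ Finset.range (j + 1),
      (P (j - l) k (q 1) * normalDeriv (P (j' + l + 1) k') 1 -
        P (j' + l + 1) k' (q 1) * normalDeriv (P (j - l) k) 1) := by
  have hΔ : ∀ j' , HasLaplacian (P (j' + 1) k') (P j' k') := fun j' =>
    (hP _ _).hasLaplacian_succ (hP _ _)
  induction j generalizing j' with
  | zero =>
    rw [(hP 0 k).innerMu_eq (hP 0 k).hasLaplacian_zero (hP (j' + 1) k') (hΔ j')]
    simp [innerMu]
  | succ j ih =>
    -- The summand `l = 0` is the boundary term of the present step; the others are the sum for `j`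
    -- and `j' + 1` with `l` shifted by one.
    rw [(hP (j + 1) k).innerMu_eq ((hP (j + 1) k).hasLaplacian_succ (hP j k)) (hP (j' + 1) k')
      (hΔ j'), ih, Finset.sum_range_succ' _ (j + 1)]
    simp only [Nat.add_sub_add_right, Nat.sub_zero, add_zero]
    congr 1
    exact Finset.sum_congr rfl fun l _ => by rw [show j' + (l + 1) + 1 = j' + 1 + l + 1 by omega]

end BubbleDiamond

/-- `P j 0` and `P j 1` are the monomials `P_{j1}` and `P_{j2}`; `q 1` is the boundary point
`q₂`. -/
theorem mainTheorem4 (b : ℕ) [NeZero b]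
    (P : ℕ → Fin 2 → C(BubbleDiamond.K b, ℝ))
    (hP : ∀ (j : ℕ) (k : Fin 2), BubbleDiamond.IsMonomial j k (P j k))
    (α β η γ : ℕ → ℝ)
    (hα : ∀ j, α j = P j 0 (BubbleDiamond.q 1))
    (hβ : ∀ j, β j = P j 1 (BubbleDiamond.q 1))
    (hη : ∀ j, η j = BubbleDiamond.normalDeriv (P j 0) 1)
    (hγ : ∀ j, γ j = BubbleDiamond.normalDeriv (P j 1) 1) :
    (∀ j, BubbleDiamond.HasNormalDeriv (P j 0) 1 (η j) ∧
      BubbleDiamond.HasNormalDeriv (P j 1) 1 (γ j)) ∧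
    ∀ j j' : ℕ,
      BubbleDiamond.innerMu (P j 0) (P j' 0) =
        ∑ l ∈ Finset.range (j + 1),
          (α (j - l) * η (j' + l + 1) - α (j' + l + 1) * η (j - l)) ∧
      BubbleDiamond.innerMu (P j 0) (P j' 1) =
        ∑ l ∈ Finset.range (j + 1),
          (α (j - l) * γ (j' + l + 1) - β (j' + l + 1) * η (j - l)) ∧
      BubbleDiamond.innerMu (P j 1) (P j' 1) =
        ∑ l ∈ Finset.range (j + 1),
          (β (j - l) * γ (j' + l + 1) - β (j' + l + 1) * γ (j - l)) := by
  obtain rfl : α = fun j => P j 0 (BubbleDiamond.q 1) := funext hα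
  obtain rfl : β = fun j => P j 1 (BubbleDiamond.q 1) := funext hβ
  obtain rfl : η = fun j => BubbleDiamond.normalDeriv (P j 0) 1 := funext hη
  obtain rfl : γ = fun j => BubbleDiamond.normalDeriv (P j 1) 1 := funext hγ
  exact ⟨fun j => ⟨(hP j 0).hasNormalDeriv 1, (hP j 1).hasNormalDeriv 1⟩, fun j j' =>
    ⟨BubbleDiamond.innerMu_monomial hP 0 0 j j', BubbleDiamond.innerMu_monomial hP 0 1 j j',
      BubbleDiamond.innerMu_monomial hP 1 1 j j'⟩⟩
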